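/- Let $0\le\alpha\le\frac14$, $c>0$, $\omega_\alpha(x)=(1-x^2)^\alpha$, and let $$\mathcal L_c^{(\alpha)}f(x)=-\frac{1}{\omega_\alpha(x)}\frac{d}{dx}\Big[\omega_\alpha(x)(1-x^2)f'(x)\Big]+c^2x^2f(x),\qquad x\in(-1,1).$$ The eigenvalues of $\mathcal L_c^{(\alpha)}$ are the real numbers $\chi$ for which $\mathcal L_c^{(\alpha)}f=\chi f$ has a bounded real-valued solution $f\not\equiv0$ on $(-1,1)$; in increasing order they are $\chi_0^\alpha(c)<\chi_1^\alpha(c)<\cdots$. For $n\in\mathbb N=\{0,1,2,\dots\}$ let $\psi=\psi_{n,c}^{(\alpha)}$ be the $n$-th generalized prolate spheroidal wave function (GPSWF), i.e. a bounded real-valued solution of $\mathcal L_c^{(\alpha)}\psi=\chi_n^\alpha(c)\,\psi$ on $(-1,1)$ normalized by $\int_{-1}^1|\psi(x)|^2\omega_\alpha(x)\,dx=1$ (at $\pm1$ it may be given any real values). Put $q=c^2/\chi_n^\alpha(c)$ and $$A^2=|\psi(0)|^2+\frac{|\psi'(0)|^2}{\chi_n^\alpha(c)}.$$ If $0<q<\frac{3}{17}$,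 then $$\sup_{x\in[0,1]}\sqrt{(1-x^2)(1-qx^2)}\;\omega_\alpha(x)\,|\psi(x)|^2\;\le\;A^2\;\le\;2\alpha+1,$$ the supremum being finite. -/

import Mathlib

open Set

noncomputable section

/-- The Gegenbauer weight `ω_α(x) = (1 - x²)^α`. -/
def gegenbauerWeight (α x : ℝ) : ℝ := (1 - x ^ 2) ^ α

/-- The differential operator
`L_c^{(α)} f = -(1/ω_α) (ω_α (1 - x²) f')' + c² x² f`. -/
def prolateOperator (α c : ℝ) (f : ℝ → ℝ) (x : ℝ) : ℝ :=
  -(1 / gegenbauerWeight α x) *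
      deriv (fun y => gegenbauerWeight α y * (1 - y ^ 2) * deriv f y) x
    + c ^ 2 * x ^ 2 * f x

/-- `f` is a bounded (classical) solution of `L_c^{(α)} f = χ f` on the interval `(-1, 1)`.
For `α ≥ 0` boundedness is the boundary condition at `±1` that singles out the self-adjoint
realization of `L_c^{(α)}` in `L²([-1, 1], ω_α)`. -/
structure IsBoundedSolution (α c χ : ℝ) (f : ℝ → ℝ) : Prop where
  differentiableOn : DifferentiableOn ℝ f (Ioo (-1) 1)
  differentiableOn_flux :
    DifferentiableOn ℝ (fun y => gegenbauerWeight α y * (1 - y ^ 2) * deriv f y) (Ioo (-1) 1)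
  equation : ∀ x ∈ Ioo (-1 : ℝ) 1, prolateOperator α c f x = χ * f x
  bounded : ∃ M : ℝ, ∀ x ∈ Ioo (-1 : ℝ) 1, |f x| ≤ M

/-- The set of eigenvalues of `L_c^{(α)}`. -/
def prolateEigenvalues (α c : ℝ) : Set ℝ :=
  {χ | ∃ f : ℝ → ℝ, IsBoundedSolution α c χ f ∧ ∃ x ∈ Ioo (-1 : ℝ) 1, f x ≠ 0}

/-- `χ` is `χ_n^α(c)`, the `(n+1)`-th eigenvalue of `L_c^{(α)}` in increasing order, `n = 0, 1, …`
(all eigenvalues are simple, so that no multiplicities have to be counted). -/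
def IsProlateEigenvalue (α c : ℝ) (n : ℕ) (χ : ℝ) : Prop :=
  χ ∈ prolateEigenvalues α c ∧ {χ' ∈ prolateEigenvalues α c | χ' < χ}.encard = n

/-- `ψ` is the generalized prolate spheroidal wave function `ψ_{n,c}^{(α)}`, with `χ = χ_n^α(c)`:
an eigenfunction of `L_c^{(α)}` for its `(n+1)`-th eigenvalue, of norm one in
`L²([-1, 1], ω_α)`. -/
structure IsGPSWF (α c : ℝ) (n : ℕ) (χ : ℝ) (ψ : ℝ → ℝ) : Prop where
  eigenvalue : IsProlateEigenvalue α c n χ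
  solution : IsBoundedSolution α c χ ψ
  normalized : ∫ x in (-1 : ℝ)..1, |ψ x| ^ 2 * gegenbauerWeight α x = 1

/-- The constant `A² = |ψ(0)|² + |ψ'(0)|² / χ`. -/
def gpswfASq (χ : ℝ) (ψ : ℝ → ℝ) : ℝ := |ψ 0| ^ 2 + |deriv ψ 0| ^ 2 / χ

/-- The quantity `√((1 - x²)(1 - q x²)) ω_α(x) |ψ(x)|²`. -/
def gpswfLocal (α q : ℝ) (ψ : ℝ → ℝ) (x : ℝ) : ℝ :=
  √((1 - x ^ 2) * (1 - q * x ^ 2)) * gegenbauerWeight α x * |ψ x| ^ 2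

end

/-! Both bounds come from energy functions adapted to the equation.

For the upper bound on the supremum, the Liouville substitution `ds/dx = √((1 - q x²)/(1 - x²))`, `U
= ((1 - x²)^(2α+1) (1 - q x²))^(1/4) ψ` gives `U'' + (χ + θ) U = 0`, and `U²` is the quantity to be
bounded. Since `θ` is nonnegative and nondecreasing in `x²` (`liouvillePotentialDeriv_nonneg`, where
`α ≤ 1/4` and the bound on `q` enter), the energy `U² + U'²/(χ + θ)` is nonincreasing on `[0, 1)`.
It dominates `U²`, and its value at `0` is at most `A²`.

For `A² ≤ 2α + 1`, the Sonin-type function `N = ω²(1 - x²)(1 - q x²) ψ² + (ω(1 - x²) ψ')²/χ` equals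
`A²` at `0`, tends to `0` along points approaching `1`, and satisfies `-N' ≤ 2(2α + 1) ω ψ²`. Hence
`A²` is at most `2(2α + 1)` times the mass of `ω ψ²` on `[0, 1]`. By reflection the same holds on
`[-1, 0]`, and the two masses sum to `1`. -/

/-- `f`, with derivative `g`, solves `(1 - x²) f'' - 2 (α + 1) x f' + χ (1 - q x²) f = 0`
on `(-1, 1)`. -/
structure ProlateODE (α χ q : ℝ) (f g : ℝ → ℝ) : Prop where
  hasDerivAt : ∀ x ∈ Ioo (-1 : ℝ) 1, HasDerivAt f (g x) x
  hasDerivAt' : ∀ x ∈ Ioo (-1 : ℝ) 1, HasDerivAt g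
    ((2 * (α + 1) * x * g x - χ * (1 - q * x ^ 2) * f x) / (1 - x ^ 2)) x

/-! ### The weight and the equation in non-divergence form -/

theorem one_sub_sq_pos_of_mem_Ioo {x : ℝ} (hx : x ∈ Ioo (-1 : ℝ) 1) : 0 < 1 - x ^ 2 := by
  nlinarith [hx.1, hx.2]

theorem hasDerivAt_one_sub_mul_sq (q x : ℝ) :
    HasDerivAt (fun y : ℝ => 1 - q * y ^ 2) (-(2 * q * x)) x := by
  have := (((hasDerivAt_id x).pow 2).const_mul q).const_sub 1
  refine this.congr_deriv ?_
  simp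
  ring

theorem hasDerivAt_one_sub_sq (x : ℝ) :
    HasDerivAt (fun y : ℝ => 1 - y ^ 2) (-(2 * x)) x := by
  simpa using hasDerivAt_one_sub_mul_sq 1 x

theorem gegenbauerWeight_pos (α : ℝ) {x : ℝ} (hx : x ∈ Ioo (-1 : ℝ) 1) :
    0 < gegenbauerWeight α x :=
  Real.rpow_pos_of_pos (one_sub_sq_pos_of_mem_Ioo hx) α

theorem gegenbauerWeight_le_one {α : ℝ} (hα : 0 ≤ α) {x : ℝ} (hx : x ∈ Ioo (-1 : ℝ) 1) :
    gegenbauerWeight α x ≤ 1 :=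
  Real.rpow_le_one (one_sub_sq_pos_of_mem_Ioo hx).le (by nlinarith) hα

theorem gegenbauerWeight_neg (α x : ℝ) : gegenbauerWeight α (-x) = gegenbauerWeight α x := by
  simp [gegenbauerWeight]

theorem hasDerivAt_gegenbauerWeight (α : ℝ) {x : ℝ} (hx : x ∈ Ioo (-1 : ℝ) 1) :
    HasDerivAt (gegenbauerWeight α) (-(2 * α * x) * gegenbauerWeight α x / (1 - x ^ 2)) x := by
  have hm := one_sub_sq_pos_of_mem_Ioo hx
  have := (hasDerivAt_one_sub_sq x).rpow_const (p := α) (Or.inl hm.ne')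
  refine this.congr_deriv ?_
  rw [Real.rpow_sub_one hm.ne', gegenbauerWeight]
  ring

/-- Only the flux is assumed differentiable; writing `f'` as the flux over `ω(1 - x²)` makes `f'`
differentiable by the quotient rule. -/
theorem IsBoundedSolution.prolateODE {α c χ q : ℝ} {f : ℝ → ℝ}
    (hf : IsBoundedSolution α c χ f) (hχ : χ ≠ 0) (hq : q = c ^ 2 / χ) :
    ProlateODE α χ q f (deriv f) := by
  refine ⟨fun x hx => (hf.differentiableOn.differentiableAt (isOpen_Ioo.mem_nhds hx)).hasDerivAt,
    fun x hx => ?_⟩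
  have hm := one_sub_sq_pos_of_mem_Ioo hx
  have hw := gegenbauerWeight_pos α hx
  have hflux := (hf.differentiableOn_flux.differentiableAt (isOpen_Ioo.mem_nhds hx)).hasDerivAt
  have heq := hf.equation x hx
  unfold prolateOperator at heq
  set D := deriv (fun y => gegenbauerWeight α y * (1 - y ^ 2) * deriv f y) x with hD
  have hp := (hasDerivAt_gegenbauerWeight α hx).mul (hasDerivAt_one_sub_sq x)
  have hquot := hflux.div hp (mul_pos hw hm).ne'
  have hev : deriv f =ᶠ[nhds x] (fun y => gegenbauerWeight α y * (1 - y ^ 2) * deriv f y) /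
      (gegenbauerWeight α * fun y => 1 - y ^ 2) := by
    filter_upwards [isOpen_Ioo.mem_nhds hx] with y hy
    have hm' := one_sub_sq_pos_of_mem_Ioo hy
    have hw' := gegenbauerWeight_pos α hy
    simp only [Pi.div_apply, Pi.mul_apply]
    field_simp
  refine (hquot.congr_of_eventuallyEq hev).congr_deriv ?_
  have hD' : D = gegenbauerWeight α x * (c ^ 2 * x ^ 2 - χ) * f x := by
    field_simp at heq
    linear_combination -heq
  have hc : c ^ 2 = q * χ := by rw [hq]; field_simp
  rw [hD', hc]
  simp only [Pi.mul_apply]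
  field_simp
  ring

theorem ProlateODE.comp_neg {α χ q : ℝ} {f g : ℝ → ℝ} (h : ProlateODE α χ q f g) :
    ProlateODE α χ q (fun x => f (-x)) (fun x => -g (-x)) := by
  have hneg : ∀ x ∈ Ioo (-1 : ℝ) 1, -x ∈ Ioo (-1 : ℝ) 1 := fun x hx =>
    ⟨by linarith [hx.2], by linarith [hx.1]⟩
  refine ⟨fun x hx => ?_, fun x hx => ?_⟩
  · exact ((h.hasDerivAt _ (hneg x hx)).comp x (hasDerivAt_neg x)).congr_deriv (by ring)
  · refine ((h.hasDerivAt' _ (hneg x hx)).comp x (hasDerivAt_neg x)).neg.congr_deriv ?_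
    ring

/-! ### Monotonicity of the Liouville potential -/

/-- The potential `θ` of the Liouville normal form `U'' + (χ + θ) U = 0`, in terms of
`a = 2 α + 1` and `t = x²`. -/
noncomputable def liouvillePotential (a q t : ℝ) : ℝ :=
  a * (2 - a) / 4 * (t / ((1 - t) * (1 - q * t))) + a / 2 / (1 - q * t)
    + q / 2 * ((1 - 2 * t) / (1 - q * t) ^ 2)
    + 5 * q ^ 2 / 4 * ((t - t ^ 2) / (1 - q * t) ^ 3)

/-- The derivative of `liouvillePotential a q`. -/
noncomputable def liouvillePotentialDeriv (a q t : ℝ) : ℝ :=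
  a * (2 - a) / 4 * ((1 - q * t ^ 2) / ((1 - t) ^ 2 * (1 - q * t) ^ 2))
    + a * q / 2 / (1 - q * t) ^ 2
    + q * ((-1 + q - q * t) / (1 - q * t) ^ 3)
    + 5 * q ^ 2 / 4 * ((1 - 2 * t + 2 * q * t - q * t ^ 2) / (1 - q * t) ^ 4)

theorem hasDerivAt_liouvillePotential (a : ℝ) {q t : ℝ} (ht : 1 - t ≠ 0) (hr : 1 - q * t ≠ 0) :
    HasDerivAt (liouvillePotential a q) (liouvillePotentialDeriv a q t) t := by
  have hid := hasDerivAt_id' t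
  have hm := hid.const_sub 1
  have hrr := (hid.const_mul q).const_sub 1
  have h1 := (hid.div (hm.mul hrr) (mul_ne_zero ht hr)).const_mul (a * (2 - a) / 4)
  have h2 := (hasDerivAt_const t (a / 2)).div hrr hr
  have h3 := (((hid.const_mul 2).const_sub 1).div (hrr.pow 2) (pow_ne_zero 2 hr)).const_mul (q / 2)
  have h4 := ((hid.sub (hid.pow 2)).div (hrr.pow 3) (pow_ne_zero 3 hr)).const_mul (5 * q ^ 2 / 4)
  refine (((h1.add h2).add h3).add h4).congr_deriv ?_
  simp only [liouvillePotentialDeriv, Pi.pow_apply, Pi.mul_apply]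
  norm_num
  field_simp
  ring

/-- After clearing `(1 - t)² (1 - q t)⁴`, the first term is bounded below because `a(2 - a) ≥ 3/4`
on `[1, 3/2]`; it outweighs the possibly negative rest. -/
theorem liouvillePotentialDeriv_nonneg {a q t : ℝ} (ha₀ : 1 ≤ a) (ha₁ : a ≤ 3 / 2) (hq₀ : 0 ≤ q)
    (hq₁ : q ≤ 3 / 17) (ht₀ : 0 ≤ t) (ht₁ : t < 1) : 0 ≤ liouvillePotentialDeriv a q t := by
  have hqt : q * t ≤ q := mul_le_of_le_one_right hq₀ ht₁.le
  have hqt₀ : 0 ≤ q * t := mul_nonneg hq₀ ht₀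
  have hr : 0 < 1 - q * t := by linarith
  have hm : 0 < 1 - t := by linarith
  have haa : 3 / 4 ≤ a * (2 - a) := by nlinarith
  have key : 0 ≤ a * (2 - a) / 4 * ((1 - q * t ^ 2) * (1 - q * t) ^ 2)
      + (1 - t) ^ 2 * (a * q / 2 * (1 - q * t) ^ 2 + q * (-1 + q - q * t) * (1 - q * t)
      + 5 * q ^ 2 / 4 * (1 - 2 * t + 2 * q * t - q * t ^ 2)) := by
    -- For `a = 1`, `t = 0` the bracket is `9q²/4 - q/2`, with minimum `-1/36` at `q = 1/9`; the
    -- loss linear in `t` is at most `q²(7/2 + q) t ≤ 3t/25`.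
    have hbr : -(1 / 36 + t * (3 / 25)) ≤ a * q / 2 * (1 - q * t) ^ 2
        + q * (-1 + q - q * t) * (1 - q * t)
        + 5 * q ^ 2 / 4 * (1 - 2 * t + 2 * q * t - q * t ^ 2) := by
      have h1 : 0 ≤ (a - 1) * (q / 2 * (1 - q * t) ^ 2) :=
        mul_nonneg (by linarith) (by positivity)
      have h2 : 0 ≤ q ^ 2 * (q * t * (2 - t)) :=
        mul_nonneg (by positivity) (mul_nonneg hqt₀ (by linarith))
      have h3 : 0 ≤ q * (q * t) ^ 2 := by positivity
      have h4 : q ^ 2 ≤ (3 / 17) ^ 2 := pow_le_pow_left₀ hq₀ hq₁ 2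
      have h5 : q ^ 2 * (7 / 2 + q) ≤ (3 / 17) ^ 2 * (7 / 2 + 3 / 17) :=
        mul_le_mul h4 (by linarith) (by linarith) (by norm_num)
      have h6 : t * (q ^ 2 * (7 / 2 + q)) ≤ t * (3 / 25) :=
        mul_le_mul_of_nonneg_left (h5.trans (by norm_num)) ht₀
      nlinarith [sq_nonneg (q - 1 / 9)]
    have hmain : 3 / 16 * (8 / 17) ≤
        a * (2 - a) / 4 * ((1 - q * t ^ 2) * (1 - q * t) ^ 2) := by
      have h1 : 1 - q * t ≤ 1 - q * t ^ 2 := by nlinarith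
      have h2 : 8 / 17 ≤ (1 - q * t ^ 2) * (1 - q * t) ^ 2 := by
        have : (1 - q * t) * (1 - q * t) ^ 2 ≤ (1 - q * t ^ 2) * (1 - q * t) ^ 2 :=
          mul_le_mul_of_nonneg_right h1 (by positivity)
        have h3 : (14 / 17 : ℝ) ^ 3 ≤ (1 - q * t) ^ 3 :=
          pow_le_pow_left₀ (by norm_num) (by linarith) 3
        nlinarith
      exact mul_le_mul (by linarith) h2 (by norm_num) (by linarith)
    have h1 : (1 - t) ^ 2 ≤ 1 := pow_le_one₀ hm.le (by linarith)
    have h2 : (1 - t) ^ 2 * t ≤ 1 / 4 := by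
      nlinarith [sq_nonneg (1 - 2 * t), mul_nonneg ht₀ hm.le, mul_nonneg (mul_nonneg ht₀ hm.le) ht₀]
    have h3 := mul_le_mul_of_nonneg_left hbr (sq_nonneg (1 - t))
    nlinarith
  have : liouvillePotentialDeriv a q t = (a * (2 - a) / 4 * ((1 - q * t ^ 2) * (1 - q * t) ^ 2)
      + (1 - t) ^ 2 * (a * q / 2 * (1 - q * t) ^ 2 + q * (-1 + q - q * t) * (1 - q * t)
      + 5 * q ^ 2 / 4 * (1 - 2 * t + 2 * q * t - q * t ^ 2))) / ((1 - t) ^ 2 * (1 - q * t) ^ 4) := by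
    unfold liouvillePotentialDeriv
    field_simp
    ring
  rw [this]
  positivity

theorem liouvillePotential_zero (a q : ℝ) : liouvillePotential a q 0 = a / 2 + q / 2 := by
  simp [liouvillePotential]

/-! ### The Liouville energy and the local bound -/

/-- A quarter of the logarithmic derivative of
`(1 - x²)^a (1 - q x²)`. -/
noncomputable def liouvilleShift (a q x : ℝ) : ℝ :=
  -(x / 2) * (a / (1 - x ^ 2) + q / (1 - q * x ^ 2))

/-- The energy `U² + (dU/ds)² / (χ + θ)` of the Liouville normal form of the prolate equation. -/
noncomputable def liouvilleEnergy (α χ q : ℝ) (f g : ℝ → ℝ) (x : ℝ) : ℝ :=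
  √((1 - x ^ 2) * (1 - q * x ^ 2)) * gegenbauerWeight α x *
    (f x ^ 2 + (1 - x ^ 2) / (1 - q * x ^ 2) * (g x + liouvilleShift (2 * α + 1) q x * f x) ^ 2 /
      (χ + liouvillePotential (2 * α + 1) q (x ^ 2)))

theorem one_sub_mul_sq_pos {q x : ℝ} (hq₁ : q < 1) (hx : x ∈ Ioo (-1 : ℝ) 1) :
    0 < 1 - q * x ^ 2 := by
  have := one_sub_sq_pos_of_mem_Ioo hx
  nlinarith [sq_nonneg x]

theorem hasDerivAt_liouvilleShift (a : ℝ) {q x : ℝ} (hm : 1 - x ^ 2 ≠ 0) (hr : 1 - q * x ^ 2 ≠ 0) :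
    HasDerivAt (liouvilleShift a q) (-(1 / 2) * (a / (1 - x ^ 2) + q / (1 - q * x ^ 2))
      - x ^ 2 * (a / (1 - x ^ 2) ^ 2 + q ^ 2 / (1 - q * x ^ 2) ^ 2)) x := by
  have h1 := (hasDerivAt_const x a).div (hasDerivAt_one_sub_sq x) hm
  have h2 := (hasDerivAt_const x q).div (hasDerivAt_one_sub_mul_sq q x) hr
  have h3 := ((hasDerivAt_id' x).div_const 2).neg
  refine (h3.mul (h1.add h2)).congr_deriv ?_
  simp only [Pi.add_apply, Pi.div_apply, Pi.neg_apply]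
  field_simp
  ring

theorem hasDerivAt_sqrt_mul_gegenbauerWeight (α : ℝ) {q x : ℝ} (hq₁ : q < 1)
    (hx : x ∈ Ioo (-1 : ℝ) 1) :
    HasDerivAt (fun y => √((1 - y ^ 2) * (1 - q * y ^ 2)) * gegenbauerWeight α y)
      (2 * liouvilleShift (2 * α + 1) q x *
        (√((1 - x ^ 2) * (1 - q * x ^ 2)) * gegenbauerWeight α x)) x := by
  have hm := one_sub_sq_pos_of_mem_Ioo hx
  have hr := one_sub_mul_sq_pos hq₁ hx
  have hmr := mul_pos hm hr
  have h1 := ((hasDerivAt_one_sub_sq x).mul (hasDerivAt_one_sub_mul_sq q x)).sqrt hmr.ne'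
  refine (h1.mul (hasDerivAt_gegenbauerWeight α hx)).congr_deriv ?_
  simp only [Pi.mul_apply]
  unfold liouvilleShift
  have hS := Real.sqrt_pos.2 hmr
  have hS2 := Real.sq_sqrt hmr.le
  set S := √((1 - x ^ 2) * (1 - q * x ^ 2))
  have : ∀ z : ℝ, z / (2 * S) = z * S / (2 * ((1 - x ^ 2) * (1 - q * x ^ 2))) := fun z => by
    rw [← hS2]; field_simp
  rw [this]
  have hr' : 1 - x ^ 2 * q ≠ 0 := by linarith
  field_simp
  ring

/-- Along `U'' = -(χ + θ) U` the cross terms cancel and only the derivative of `1/(χ + θ)` survives.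
-/
theorem ProlateODE.hasDerivAt_liouvilleEnergy {α χ q : ℝ} {f g : ℝ → ℝ}
    (h : ProlateODE α χ q f g) (hq₁ : q < 1) {x : ℝ} (hx : x ∈ Ioo (-1 : ℝ) 1)
    (hT : χ + liouvillePotential (2 * α + 1) q (x ^ 2) ≠ 0) :
    HasDerivAt (liouvilleEnergy α χ q f g)
      (-(√((1 - x ^ 2) * (1 - q * x ^ 2)) * gegenbauerWeight α x *
        ((1 - x ^ 2) / (1 - q * x ^ 2) * (g x + liouvilleShift (2 * α + 1) q x * f x) ^ 2 *
        (liouvillePotentialDeriv (2 * α + 1) q (x ^ 2) * (2 * x)) /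
        (χ + liouvillePotential (2 * α + 1) q (x ^ 2)) ^ 2))) x := by
  have hm := one_sub_sq_pos_of_mem_Ioo hx
  have hr := one_sub_mul_sq_pos hq₁ hx
  have hs := hasDerivAt_sqrt_mul_gegenbauerWeight α hq₁ hx
  have hh := hasDerivAt_liouvilleShift (2 * α + 1) hm.ne' hr.ne'
  have hf := h.hasDerivAt x hx
  have hw := (h.hasDerivAt' x hx).add (hh.mul hf)
  have hκ := (hasDerivAt_one_sub_sq x).div (hasDerivAt_one_sub_mul_sq q x) hr.ne'
  have hsq : HasDerivAt (fun y : ℝ => y ^ 2) (2 * x) x := by simpa using hasDerivAt_pow 2 x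
  have hTT := (HasDerivAt.comp (h := fun y : ℝ => y ^ 2) x
    (hasDerivAt_liouvillePotential (2 * α + 1) (q := q) hm.ne' hr.ne') hsq).const_add χ
  have hE := hs.mul ((hf.pow 2).add ((hκ.mul (hw.pow 2)).div hTT hT))
  refine hE.congr_deriv ?_
  clear hE hTT hsq hκ hw hf hh hs
  simp only [Pi.mul_apply, Pi.add_apply, Pi.pow_apply, Pi.div_apply, Function.comp_apply]
  -- This is `U'' = -(χ + θ) U` written in the variable `x` and divided by the prefactor of `U`,
  -- with `κ = (dx/ds)²` and `w = f' + η f`.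
  have hκw : (1 - x ^ 2) / (1 - q * x ^ 2) *
      ((2 * (α + 1) * x * g x - χ * (1 - q * x ^ 2) * f x) / (1 - x ^ 2) +
        ((-(1 / 2) * ((2 * α + 1) / (1 - x ^ 2) + q / (1 - q * x ^ 2))
          - x ^ 2 * ((2 * α + 1) / (1 - x ^ 2) ^ 2 + q ^ 2 / (1 - q * x ^ 2) ^ 2)) * f x
        + liouvilleShift (2 * α + 1) q x * g x)) =
      -(liouvilleShift (2 * α + 1) q x * ((1 - x ^ 2) / (1 - q * x ^ 2))
        + (-(2 * x) * (1 - q * x ^ 2) - (1 - x ^ 2) * -(2 * q * x)) / (1 - q * x ^ 2) ^ 2 / 2)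
        * (g x + liouvilleShift (2 * α + 1) q x * f x)
      - (χ + liouvillePotential (2 * α + 1) q (x ^ 2)) * f x := by
    have hr' : 1 - x ^ 2 * q ≠ 0 := by linarith
    unfold liouvilleShift liouvillePotential
    field_simp
    ring
  generalize (2 * (α + 1) * x * g x - χ * (1 - q * x ^ 2) * f x) / (1 - x ^ 2) +
        ((-(1 / 2) * ((2 * α + 1) / (1 - x ^ 2) + q / (1 - q * x ^ 2))
          - x ^ 2 * ((2 * α + 1) / (1 - x ^ 2) ^ 2 + q ^ 2 / (1 - q * x ^ 2) ^ 2)) * f x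
        + liouvilleShift (2 * α + 1) q x * g x) = w' at hκw ⊢
  generalize (-(2 * x) * (1 - q * x ^ 2) - (1 - x ^ 2) * -(2 * q * x)) / (1 - q * x ^ 2) ^ 2 = κ'
    at hκw ⊢
  generalize (1 - x ^ 2) / (1 - q * x ^ 2) = κ at hκw ⊢
  generalize χ + liouvillePotential (2 * α + 1) q (x ^ 2) = T at hκw hT ⊢
  generalize liouvillePotentialDeriv (2 * α + 1) q (x ^ 2) = T'
  generalize √((1 - x ^ 2) * (1 - q * x ^ 2)) * gegenbauerWeight α x = s
  generalize liouvilleShift (2 * α + 1) q x = η at hκw ⊢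
  norm_num
  field_simp
  linear_combination (2 * s * T * (g x + η * f x)) * hκw

theorem liouvillePotential_nonneg {a q t : ℝ} (ha₀ : 1 ≤ a) (ha₁ : a ≤ 3 / 2) (hq₀ : 0 ≤ q)
    (hq₁ : q ≤ 3 / 17) (ht₀ : 0 ≤ t) (ht₁ : t < 1) : 0 ≤ liouvillePotential a q t := by
  have hD : ∀ y ∈ Ico (0 : ℝ) 1, HasDerivAt (liouvillePotential a q)
      (liouvillePotentialDeriv a q y) y := fun y hy => by
    refine hasDerivAt_liouvillePotential a (by linarith [hy.2]) ?_
    have := mul_le_mul hq₁ hy.2.le hy.1 (by norm_num)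
    linarith
  have hmono : MonotoneOn (liouvillePotential a q) (Ico 0 1) := by
    refine monotoneOn_of_hasDerivWithinAt_nonneg (convex_Ico 0 1)
      (fun y hy => (hD y hy).continuousAt.continuousWithinAt)
      (fun y hy => (hD y (interior_subset hy)).hasDerivWithinAt) fun y hy => ?_
    have hy' := interior_subset hy
    exact liouvillePotentialDeriv_nonneg ha₀ ha₁ hq₀ hq₁ hy'.1 hy'.2
  have := hmono ⟨le_rfl, one_pos⟩ ⟨ht₀, ht₁⟩ ht₀
  rw [liouvillePotential_zero] at this
  linarith

theorem ProlateODE.sqrt_mul_gegenbauerWeight_mul_sq_le {α χ q : ℝ} {f g : ℝ → ℝ}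
    (h : ProlateODE α χ q f g) (hα₀ : 0 ≤ α) (hα₁ : α ≤ 1 / 4) (hχ : 0 < χ) (hq₀ : 0 ≤ q)
    (hq₁ : q ≤ 3 / 17) {x : ℝ} (hx : x ∈ Ico (0 : ℝ) 1) :
    √((1 - x ^ 2) * (1 - q * x ^ 2)) * gegenbauerWeight α x * f x ^ 2 ≤
      f 0 ^ 2 + g 0 ^ 2 / χ := by
  have hsub : Ico (0 : ℝ) 1 ⊆ Ioo (-1) 1 := fun y hy => ⟨by linarith [hy.1], hy.2⟩
  have hsq : ∀ y ∈ Ico (0 : ℝ) 1, y ^ 2 < 1 := fun y hy => by nlinarith [hy.1, hy.2]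
  have hT : ∀ y ∈ Ico (0 : ℝ) 1, 0 < χ + liouvillePotential (2 * α + 1) q (y ^ 2) := fun y hy =>
    add_pos_of_pos_of_nonneg hχ (liouvillePotential_nonneg (by linarith) (by linarith) hq₀ hq₁
      (sq_nonneg y) (hsq y hy))
  have hκ : ∀ y ∈ Ico (0 : ℝ) 1, 0 ≤ (1 - y ^ 2) / (1 - q * y ^ 2) := fun y hy =>
    div_nonneg (one_sub_sq_pos_of_mem_Ioo (hsub hy)).le
      (one_sub_mul_sq_pos (by linarith) (hsub hy)).le
  have hanti : AntitoneOn (liouvilleEnergy α χ q f g) (Ico 0 1) := by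
    have hD := fun y hy =>
      h.hasDerivAt_liouvilleEnergy (x := y) (by linarith) (hsub hy) (hT y hy).ne'
    refine antitoneOn_of_hasDerivWithinAt_nonpos (convex_Ico 0 1)
      (fun y hy => (hD y hy).continuousAt.continuousWithinAt)
      (fun y hy => (hD y (interior_subset hy)).hasDerivWithinAt) fun y hy => ?_
    have hy' := interior_subset hy
    have h1 := gegenbauerWeight_pos α (hsub hy')
    have h2 := hκ y hy'
    have h3 := liouvillePotentialDeriv_nonneg (a := 2 * α + 1) (by linarith) (by linarith) hq₀ hq₁
      (sq_nonneg y) (hsq y hy')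
    have h4 := hy'.1
    rw [neg_nonpos]
    positivity
  have h0 : (0 : ℝ) ∈ Ico (0 : ℝ) 1 := ⟨le_rfl, one_pos⟩
  have hle := hanti h0 hx hx.1
  have hw := gegenbauerWeight_pos α (hsub hx)
  have hκx := hκ x hx
  have hTx := hT x hx
  refine (mul_le_mul_of_nonneg_left (le_add_of_nonneg_right ?_) ?_).trans (hle.trans ?_)
  · positivity
  · positivity
  · have hθ : χ ≤ χ + ((2 * α + 1) / 2 + q / 2) := by linarith
    have := div_le_div_of_nonneg_left (sq_nonneg (g 0)) hχ hθ
    simpa [liouvilleEnergy, liouvilleShift, gegenbauerWeight, liouvillePotential_zero] using this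

/-! ### Behaviour near the endpoint and the bound on `A²` -/

/-- A bounded differentiable function on `(-1, 1)` has points arbitrarily close to `1` at which
`(1 - x) f'(x)` is small. -/
theorem exists_abs_one_sub_mul_deriv_le {f g : ℝ → ℝ} {M b ε : ℝ}
    (hf : ∀ x ∈ Ioo (-1 : ℝ) 1, HasDerivAt f (g x) x) (hM : ∀ x ∈ Ioo (-1 : ℝ) 1, |f x| ≤ M)
    (hb₀ : -1 < b) (hb₁ : b < 1) (hε : 0 < ε) : ∃ ξ ∈ Ioo b 1, |(1 - ξ) * g ξ| ≤ ε := by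
  have hM0 : 0 ≤ M := (abs_nonneg _).trans (hM b ⟨hb₀, hb₁⟩)
  -- Cauchy's mean value theorem against `-log (1 - x)`, which grows by exactly `K` from `b` to
  -- `b'`, while `f` changes by at most `2M ≤ ε K`.
  set K : ℝ := 2 * M / ε + 1 with hK
  have hK0 : 0 < K := by positivity
  have hexp : Real.exp (-K) < 1 := Real.exp_zero ▸ Real.exp_lt_exp.2 (by linarith)
  have h1b : 0 < 1 - b := by linarith
  set b' : ℝ := 1 - (1 - b) * Real.exp (-K) with hb'
  have hbb' : b < b' := by nlinarith
  have hb'1 : b' < 1 := by have := mul_pos h1b (Real.exp_pos (-K)); linarith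
  have hlog : ∀ x ∈ Icc b b', HasDerivAt (fun y => -Real.log (1 - y)) (1 / (1 - x)) x :=
    fun x hx => by
      have h0 : 1 - x ≠ 0 := by linarith [hx.2]
      refine (((hasDerivAt_id' x).const_sub 1).log h0).neg.congr_deriv ?_
      ring
  have hmem : ∀ x ∈ Icc b b', x ∈ Ioo (-1 : ℝ) 1 := fun x hx =>
    ⟨by linarith [hx.1], by linarith [hx.2]⟩
  obtain ⟨ξ, hξ, heq⟩ := exists_ratio_hasDerivAt_eq_ratio_slope f g hbb'
    (fun x hx => (hf x (hmem x hx)).continuousAt.continuousWithinAt)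
    (fun x hx => hf x (hmem x (Ioo_subset_Icc_self hx)))
    (fun y => -Real.log (1 - y)) (fun x => 1 / (1 - x))
    (fun x hx => (hlog x hx).continuousAt.continuousWithinAt)
    (fun x hx => hlog x (Ioo_subset_Icc_self hx))
  have hlogb' : Real.log (1 - b') = Real.log (1 - b) - K := by
    rw [hb', sub_sub_cancel, Real.log_mul h1b.ne' (Real.exp_pos _).ne', Real.log_exp]
    ring
  have h1ξ : 0 < 1 - ξ := by linarith [hξ.2]
  have heq' : (1 - ξ) * g ξ * K = f b' - f b := by
    rw [hlogb'] at heq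
    field_simp at heq
    linear_combination heq
  refine ⟨ξ, ⟨hξ.1, hξ.2.trans hb'1⟩, ?_⟩
  have h1 : |(1 - ξ) * g ξ| * K ≤ ε * K := by
    rw [← abs_of_pos hK0, ← abs_mul, abs_of_pos hK0, heq']
    have h2 := abs_sub (f b') (f b)
    have h3 := hM b' (hmem b' ⟨hbb'.le, le_rfl⟩)
    have h4 := hM b ⟨hb₀, hb₁⟩
    have h5 : ε * K = 2 * M + ε := by rw [hK]; field_simp
    linarith
  exact le_of_mul_le_mul_right h1 hK0

/-- Since `(ω(1 - x²) f')' = -χ ω(1 - q x²) f`, the `f f'` terms of `N'` cancel, leaving a multiple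
of `f²` to integrate from `0` towards `1`. -/
theorem ProlateODE.sq_zero_add_le {α χ q M : ℝ} {f g : ℝ → ℝ}
    (h : ProlateODE α χ q f g) (hα₀ : 0 ≤ α) (hχ : 0 < χ) (hq₀ : 0 ≤ q)
    (hq₁ : q ≤ 1 / 5) (hM : ∀ x ∈ Ioo (-1 : ℝ) 1, |f x| ≤ M)
    (hint : IntervalIntegrable (fun x => |f x| ^ 2 * gegenbauerWeight α x) MeasureTheory.volume 0 1) :
    f 0 ^ 2 + g 0 ^ 2 / χ ≤
      2 * (2 * α + 1) * ∫ x in (0 : ℝ)..1, |f x| ^ 2 * gegenbauerWeight α x := by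
  set I := ∫ x in (0 : ℝ)..1, |f x| ^ 2 * gegenbauerWeight α x with hI
  set N : ℝ → ℝ := fun x => gegenbauerWeight α x ^ 2 * ((1 - x ^ 2) * (1 - q * x ^ 2)) * f x ^ 2 +
    (gegenbauerWeight α x * (1 - x ^ 2) * g x) ^ 2 / χ with hN
  have hsub : Ico (0 : ℝ) 1 ⊆ Ioo (-1) 1 := fun y hy => ⟨by linarith [hy.1], hy.2⟩
  have hND : ∀ x ∈ Ico (0 : ℝ) 1, HasDerivAt N (-(2 * x * gegenbauerWeight α x ^ 2 *
      ((2 * α + 1) * (1 - q * x ^ 2) + q * (1 - x ^ 2)) * f x ^ 2)) x := fun x hx => by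
    have hm := one_sub_sq_pos_of_mem_Ioo (hsub hx)
    have hw := hasDerivAt_gegenbauerWeight α (hsub hx)
    have hf := h.hasDerivAt x (hsub hx)
    have hg := h.hasDerivAt' x (hsub hx)
    have hm' := hasDerivAt_one_sub_sq x
    refine ((((hw.pow 2).mul (hm'.mul (hasDerivAt_one_sub_mul_sq q x))).mul (hf.pow 2)).add
      ((((hw.mul hm').mul hg).pow 2).div_const χ)).congr_deriv ?_
    simp only [Pi.mul_apply, Pi.pow_apply]
    norm_num
    field_simp
    ring
  have hle : ∀ x ∈ Ico (0 : ℝ) 1, 2 * x * gegenbauerWeight α x ^ 2 *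
      ((2 * α + 1) * (1 - q * x ^ 2) + q * (1 - x ^ 2)) * f x ^ 2 ≤
      2 * (2 * α + 1) * (|f x| ^ 2 * gegenbauerWeight α x) := fun x hx => by
    have hm := one_sub_sq_pos_of_mem_Ioo (hsub hx)
    have hw := gegenbauerWeight_pos α (hsub hx)
    have hw1 := gegenbauerWeight_le_one hα₀ (hsub hx)
    have hx0 := hx.1
    have hx1 := hx.2
    -- For `q ≤ 1/5` the left side is increasing on `[0, 1]`, with value `1 - q` at `1`.
    have hpoly : x * (1 + q - 2 * q * x ^ 2) ≤ 1 := by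
      nlinarith [mul_nonneg hq₀ (mul_nonneg hx0 (sq_nonneg (1 - x))),
        mul_nonneg (mul_nonneg hx0 (sub_nonneg.2 hx1.le)) hq₀]
    have h1 : x * ((2 * α + 1) * (1 - q * x ^ 2) + q * (1 - x ^ 2)) ≤ 2 * α + 1 := by
      have : 0 ≤ 2 * α * (x * (q * (1 - x ^ 2))) := by positivity
      nlinarith
    have h2 : gegenbauerWeight α x *
        (x * ((2 * α + 1) * (1 - q * x ^ 2) + q * (1 - x ^ 2))) ≤ 2 * α + 1 := by
      have h0 : 0 ≤ x * ((2 * α + 1) * (1 - q * x ^ 2) + q * (1 - x ^ 2)) := by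
        have := one_sub_mul_sq_pos (q := q) (by linarith) (hsub hx)
        positivity
      exact (mul_le_of_le_one_left h0 hw1).trans h1
    have h3 := mul_le_mul_of_nonneg_left h2 (by positivity : 0 ≤ 2 * (gegenbauerWeight α x * f x ^ 2))
    rw [sq_abs]
    linarith
  have hw0 : gegenbauerWeight α 0 = 1 := by simp [gegenbauerWeight]
  have hN0 : N 0 = f 0 ^ 2 + g 0 ^ 2 / χ := by simp [hN, hw0]
  have hnn : ∀ x ∈ Icc (0 : ℝ) 1, 0 ≤ |f x| ^ 2 * gegenbauerWeight α x := fun x hx =>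
    mul_nonneg (by positivity) (Real.rpow_nonneg (by nlinarith [hx.1, hx.2]) α)
  have hstep : ∀ b ∈ Ico (0 : ℝ) 1, N 0 ≤ N b + 2 * (2 * α + 1) * I := fun b hb => by
    have hIcc : Icc 0 b ⊆ Ico (0 : ℝ) 1 := Icc_subset_Ico_right hb.2
    have hintb : IntervalIntegrable (fun x => |f x| ^ 2 * gegenbauerWeight α x)
        MeasureTheory.volume 0 b := hint.mono_set (by
      rw [uIcc_of_le hb.1, uIcc_of_le zero_le_one]; exact Icc_subset_Icc_right hb.2.le)
    have h1 := intervalIntegral.sub_le_integral_of_hasDeriv_right_of_le (g := fun x => -N x)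
      (g' := fun x => 2 * x * gegenbauerWeight α x ^ 2 *
      ((2 * α + 1) * (1 - q * x ^ 2) + q * (1 - x ^ 2)) * f x ^ 2)
      (φ := fun x => 2 * (2 * α + 1) * (|f x| ^ 2 * gegenbauerWeight α x)) hb.1
      (fun x hx => (hND x (hIcc hx)).neg.continuousAt.continuousWithinAt)
      (fun x hx => by
        exact ((hND x (hIcc (Ioo_subset_Icc_self hx))).neg.congr_deriv (neg_neg _)).hasDerivWithinAt)
      ((intervalIntegrable_iff_integrableOn_Icc_of_le hb.1).1 (hintb.const_mul _))
      (fun x hx => hle x (hIcc (Ioo_subset_Icc_self hx)))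
    rw [intervalIntegral.integral_const_mul] at h1
    have h2 : ∫ x in (0 : ℝ)..b, |f x| ^ 2 * gegenbauerWeight α x ≤ I := by
      refine intervalIntegral.integral_mono_interval le_rfl hb.1 hb.2.le ?_ hint
      refine (MeasureTheory.ae_restrict_mem measurableSet_Ioc).mono fun x hx => ?_
      exact hnn x (Ioc_subset_Icc_self hx)
    have h3 := mul_le_mul_of_nonneg_left h2 (by positivity : 0 ≤ 2 * (2 * α + 1))
    linarith
  rw [← hN0]
  refine le_of_forall_pos_le_add fun ε hε => ?_
  have hM0 : 0 ≤ M := (abs_nonneg _).trans (hM 0 (by norm_num))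
  -- The expression bounds `N ξ` when `1 - ξ ≤ δ` and `|(1 - ξ) f'(ξ)| ≤ δ`, using `ω ≤ 1` and `1 +
  -- ξ ≤ 2`.
  obtain ⟨δ, hδ, hδε⟩ : ∃ δ : ℝ, 0 < δ ∧ 2 * δ * M ^ 2 + 4 * δ ^ 2 / χ ≤ ε := by
    have hc : Filter.Tendsto (fun δ : ℝ => 2 * δ * M ^ 2 + 4 * δ ^ 2 / χ)
        (nhdsWithin 0 (Ioi 0)) (nhds 0) := by
      have : Continuous fun δ : ℝ => 2 * δ * M ^ 2 + 4 * δ ^ 2 / χ := by fun_prop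
      simpa using (this.tendsto 0).mono_left nhdsWithin_le_nhds
    have h1 := (hc.eventually_lt_const hε).and self_mem_nhdsWithin
    obtain ⟨δ, h2, h3⟩ := h1.exists
    exact ⟨δ, h3, h2.le⟩
  obtain ⟨ξ, hξ, hξδ⟩ := exists_abs_one_sub_mul_deriv_le h.hasDerivAt hM
    (b := max 0 (1 - δ)) (lt_max_of_lt_left (by norm_num)) (max_lt one_pos (by linarith)) hδ
  have hξ0 : 0 < ξ := (le_max_left _ _).trans_lt hξ.1
  have hξ1 : 1 - δ < ξ := (le_max_right _ _).trans_lt hξ.1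
  have hξm : ξ ∈ Ico (0 : ℝ) 1 := ⟨hξ0.le, hξ.2⟩
  have hm := one_sub_sq_pos_of_mem_Ioo (hsub hξm)
  have hr := one_sub_mul_sq_pos (q := q) (by linarith) (hsub hξm)
  have hw := gegenbauerWeight_pos α (hsub hξm)
  have hw1 := gegenbauerWeight_le_one hα₀ (hsub hξm)
  have hNξ : N ξ ≤ ε := by
    refine le_trans (add_le_add ?_ ?_) hδε
    · have h1 : f ξ ^ 2 ≤ M ^ 2 := sq_le_sq' (abs_le.1 (hM ξ (hsub hξm))).1
        (abs_le.1 (hM ξ (hsub hξm))).2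
      have h2 : (1 - ξ ^ 2) * (1 - q * ξ ^ 2) ≤ 2 * δ := by
        have : (1 - ξ ^ 2) * (1 - q * ξ ^ 2) ≤ 1 - ξ ^ 2 :=
          mul_le_of_le_one_right hm.le (by nlinarith [mul_nonneg hq₀ (sq_nonneg ξ)])
        nlinarith [hξ.2]
      have h3 : gegenbauerWeight α ξ ^ 2 * ((1 - ξ ^ 2) * (1 - q * ξ ^ 2)) ≤ 2 * δ :=
        (mul_le_of_le_one_left (mul_pos hm hr).le (pow_le_one₀ hw.le hw1)).trans h2
      exact mul_le_mul h3 h1 (sq_nonneg _) (by positivity)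
    · refine div_le_div_of_nonneg_right ?_ hχ.le
      have h1 : gegenbauerWeight α ξ * (1 + ξ) ≤ 2 := by nlinarith [hξ.2]
      have h2 : |gegenbauerWeight α ξ * (1 - ξ ^ 2) * g ξ| ≤ 2 * δ := by
        have : gegenbauerWeight α ξ * (1 - ξ ^ 2) * g ξ =
            gegenbauerWeight α ξ * (1 + ξ) * ((1 - ξ) * g ξ) := by ring
        rw [this, abs_mul, abs_of_nonneg (by positivity)]
        exact mul_le_mul h1 hξδ (abs_nonneg _) (by norm_num)
      rw [← sq_abs]
      calc _ ≤ (2 * δ) ^ 2 := pow_le_pow_left₀ (abs_nonneg _) h2 2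
        _ = _ := by ring
  linarith [hstep ξ hξm]

/-! ### Conclusion -/

theorem mainTheorem3 (α c : ℝ) (hα₀ : 0 ≤ α) (hα₁ : α ≤ 1 / 4) (hc : 0 < c) (n : ℕ)
    (χ : ℝ) (ψ : ℝ → ℝ) (hψ : IsGPSWF α c n χ ψ)
    (q : ℝ) (hq : q = c ^ 2 / χ) (hq₀ : 0 < q) (hq₁ : q < 3 / 17) :
    BddAbove (gpswfLocal α q ψ '' Set.Icc 0 1) ∧
      sSup (gpswfLocal α q ψ '' Set.Icc 0 1) ≤ gpswfASq χ ψ ∧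
      gpswfASq χ ψ ≤ 2 * α + 1 := by
  have hχ : 0 < χ := by
    rw [hq] at hq₀
    exact (div_pos_iff_of_pos_left (by positivity)).1 hq₀
  have hode := hψ.solution.prolateODE hχ.ne' hq
  have hA : gpswfASq χ ψ = ψ 0 ^ 2 + deriv ψ 0 ^ 2 / χ := by simp [gpswfASq]
  have hloc : ∀ y ∈ gpswfLocal α q ψ '' Set.Icc 0 1, y ≤ gpswfASq χ ψ := by
    rintro _ ⟨x, hx, rfl⟩
    rw [hA, gpswfLocal, sq_abs]
    rcases hx.2.eq_or_lt with rfl | hx1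
    · simp only [one_pow, sub_self, zero_mul, Real.sqrt_zero]
      positivity
    · exact hode.sqrt_mul_gegenbauerWeight_mul_sq_le hα₀ hα₁ hχ hq₀.le hq₁.le ⟨hx.1, hx1⟩
  refine ⟨⟨_, hloc⟩, csSup_le (by simp) hloc, ?_⟩
  obtain ⟨M, hM⟩ := hψ.solution.bounded
  have hnorm := hψ.normalized
  -- The integral of a non-integrable function is `0` by convention, so the normalization forces
  -- integrability.
  have hint : IntervalIntegrable (fun x => |ψ x| ^ 2 * gegenbauerWeight α x)
      MeasureTheory.volume (-1) 1 :=
    intervalIntegral.intervalIntegrable_of_integral_ne_zero (by rw [hnorm]; exact one_ne_zero)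
  have hintr := hint.mono_set (c := 0) (d := 1) (by
    rw [uIcc_of_le (by norm_num), uIcc_of_le (by norm_num)]; exact Icc_subset_Icc_left (by norm_num))
  have hintl := hint.mono_set (c := -1) (d := 0) (by
    rw [uIcc_of_le (by norm_num), uIcc_of_le (by norm_num)]; exact Icc_subset_Icc_right (by norm_num))
  have hr := hode.sq_zero_add_le hα₀ hχ hq₀.le (by linarith) hM hintr
  -- The reflected solution has the same `A²`, so this bounds `A²` by the mass on `[-1, 0]`.
  have hl := hode.comp_neg.sq_zero_add_le hα₀ hχ hq₀.le (by linarith)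
    (fun x hx => hM (-x) ⟨by linarith [hx.2], by linarith [hx.1]⟩) (by
      have := (IntervalIntegrable.iff_comp_neg enorm_ne_top).1 hintl.symm
      simpa [gegenbauerWeight_neg] using this)
  have hsymm : ∫ x in (0 : ℝ)..1, |ψ (-x)| ^ 2 * gegenbauerWeight α x =
      ∫ x in (-1 : ℝ)..0, |ψ x| ^ 2 * gegenbauerWeight α x := by
    have := intervalIntegral.integral_comp_neg (a := 0) (b := 1)
      (fun x => |ψ x| ^ 2 * gegenbauerWeight α x)
    simpa only [gegenbauerWeight_neg, neg_zero] using this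
  rw [hsymm] at hl
  simp only [neg_zero, neg_sq] at hl
  rw [← intervalIntegral.integral_add_adjacent_intervals hintl hintr] at hnorm
  rw [hA]
  nlinarith
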